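/- Let $G$ be a locally compact, $\sigma$-compact Hausdorff group with left Haar measure $\mu$, and let $L^2(G) = L^2(G,\mu)$ be the space of square integrable complex-valued functions on $G$, modulo equality almost everywhere. For $g \in G$ and $f \in L^2(G)$ put $(L(g)f)(x) = f(g^{-1}x)$. Let $K$ be a discrete subgroup of $G$ that is torsion-free (its only element of finite order is the identity) and that satisfies the strong Atiyah conjecture, in the following sense. The group ring $\mathbb{C}K$ acts on $\ell^2(K)$ by left convolution, so that every $m \times n$ matrix $A$ over $\mathbb{C}K$ defines a bounded operator $A \colon \ell^2(K)^n \to \ell^2(K)^m$; let $P_A$ be the orthogonal projection of $\ell^2(K)^n$ onto $\ker A$, and let $e_j \in \ell^2(K)^n$ be the vector whose $j$-th entry is the unit mass at $1 \in K$ and whose other entries are $0$. It is required that, for all $m$, $n$ and $A$, the von Neumann dimension $$\dim_{\mathcal{N}(K)} \ker A = \sum_{j=1}^n \langle P_A e_j, e_j\rangle$$ lies in the additive subgroup of $\mathbb{R}$ generated by the numbers $1/|F|$, where $F$ runs through the finite subgroups of $K$. Then every nonzero $f \in L^2(G)$ has linearly independent left $K$-translations: if $k_1, \dots, k_n \in K$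 are distinct and $c_1, \dots, c_n \in \mathbb{C}$ satisfy $\sum_{i=1}^n c_i L(k_i) f = 0$ in $L^2(G)$, then $c_1 = \dots = c_n = 0$. -/

import Mathlib

open MeasureTheory
open scoped ENNReal

noncomputable section

namespace StrongAtiyah

/-- The Hilbert space `ℓ²(K)` of square summable complex functions on the discrete group `K`. -/
abbrev Ell2 (K : Type*) : Type _ := lp (fun _ : K => ℂ) 2

/-- The left translate `x ↦ f (g⁻¹ * x)` of a square summable function is square summable. -/
theorem memℓp_ell2Translate {K : Type*} [Group K] (g : K) (f : Ell2 K) :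
    Memℓp (fun x : K => f (g⁻¹ * x)) 2 := by
  have h : (0 : ℝ) < (2 : ℝ≥0∞).toReal := by norm_num
  refine memℓp_gen ?_
  exact ((Equiv.mulLeft g⁻¹).summable_iff
    (f := fun x : K => ‖f x‖ ^ (2 : ℝ≥0∞).toReal)).2 ((memℓp_gen_iff h).1 (lp.memℓp f))

/-- Left translation on `ℓ²(K)`: `(L_g f)(x) = f(g⁻¹ x)`. -/
def ell2Translate {K : Type*} [Group K] (g : K) : Ell2 K →ₗᵢ[ℂ] Ell2 K where
  toFun f := ⟨fun x => f (g⁻¹ * x), memℓp_ell2Translate g f⟩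
  map_add' _ _ := rfl
  map_smul' _ _ := rfl
  norm_map' f := by
    have h : (0 : ℝ) < (2 : ℝ≥0∞).toReal := by norm_num
    rw [lp.norm_eq_tsum_rpow h, lp.norm_eq_tsum_rpow h]
    congr 1
    exact (Equiv.mulLeft g⁻¹).tsum_eq (fun x : K => ‖f x‖ ^ (2 : ℝ≥0∞).toReal)

/-- Left convolution by `α = ∑ a_g g ∈ ℂK`, as a bounded operator on `ℓ²(K)`:
`α * f = ∑ a_g L_g f`. -/
def groupRingAction {K : Type*} [Group K] (α : MonoidAlgebra ℂ K) : Ell2 K →L[ℂ] Ell2 K :=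
  α.coeff.sum fun g a => a • (ell2Translate g).toContinuousLinearMap

/-- The Hilbert space `ℓ²(K)ⁿ`. -/
abbrev Ell2Pow (K : Type*) (n : ℕ) : Type _ := PiLp 2 (fun _ : Fin n => Ell2 K)

/-- The bounded operator `ℓ²(K)ⁿ → ℓ²(K)ᵐ` of an `m × n` matrix over `ℂK`:
`(A v)_i = ∑ j, A_ij * v_j`. -/
def matrixOperator {K : Type*} [Group K] {m n : ℕ}
    (A : Matrix (Fin m) (Fin n) (MonoidAlgebra ℂ K)) : Ell2Pow K n →L[ℂ] Ell2Pow K m :=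
  ((PiLp.continuousLinearEquiv 2 ℂ (fun _ : Fin m => Ell2 K)).symm :
      (Fin m → Ell2 K) →L[ℂ] Ell2Pow K m) ∘L
    ContinuousLinearMap.pi fun i =>
      ∑ j, groupRingAction (A i j) ∘L PiLp.proj 2 (fun _ : Fin n => Ell2 K) j

/-- The standard vector of `ℓ²(K)ⁿ` whose `j`-th entry is the unit mass at `1 ∈ K`. -/
def standardVector (K : Type*) [Group K] {n : ℕ} (j : Fin n) : Ell2Pow K n :=
  open Classical in PiLp.single 2 j (lp.single 2 (1 : K) (1 : ℂ))

/-- The von Neumann dimension over `𝒩(K)` of a closed subspace `V` of `ℓ²(K)ⁿ` (invariant under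
right translations): the von Neumann trace `∑ j, ⟨e_j, P e_j⟩` of the orthogonal projection `P`
onto `V`. -/
def vonNeumannDim {K : Type*} [Group K] {n : ℕ} (V : Submodule ℂ (Ell2Pow K n))
    [V.HasOrthogonalProjection] : ℝ :=
  ∑ j : Fin n, (inner ℂ (standardVector K j) (V.starProjection (standardVector K j))).re

/-- The additive subgroup of `ℝ` generated by the numbers `1 / |F|`, where `F` runs through the
finite subgroups of `K`. -/
def finiteSubgroupLattice (K : Type*) [Group K] : AddSubgroup ℝ :=
  AddSubgroup.closure {r : ℝ | ∃ F : Subgroup K, Finite F ∧ r = 1 / (Nat.card F : ℝ)}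

/-- The group `K` satisfies the strong Atiyah conjecture (over `ℂ`): for every matrix over `ℂK`,
the von Neumann dimension of its kernel on `ℓ²(K)ⁿ` lies in the additive group generated by the
inverses of the orders of the finite subgroups of `K`. -/
def StrongAtiyahConjecture (K : Type*) [Group K] : Prop :=
  ∀ (m n : ℕ) (A : Matrix (Fin m) (Fin n) (MonoidAlgebra ℂ K)),
    vonNeumannDim (matrixOperator A).ker ∈ finiteSubgroupLattice K

/-- Left translation on `L²(G)`: `(L(g) f)(x) = f(g⁻¹ x)`. -/
def leftTranslation {G : Type*} [Group G] [MeasurableSpace G] [MeasurableMul G]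
    {μ : Measure G} [μ.IsMulLeftInvariant] (g : G) (f : Lp ℂ 2 μ) : Lp ℂ 2 μ :=
  Lp.compMeasurePreserving (fun x : G => g⁻¹ * x) (measurePreserving_mul_left μ g⁻¹) f

end StrongAtiyah

end

namespace StrongAtiyah

section Group

variable {Γ : Type*} [Group Γ]

/-! A relation among the translates of `f` restricts, for almost every `x`, to a convolution
equation `α * v = 0` with `v k = f (k * x)`, and `v` lies in `ℓ²(K)` for almost every `x`
(`ae_memℓp_coset`). Suppose `α ≠ 0`, and let `P` project onto the kernel of `α`, `e` being the unit
mass at `1`. Torsion-freeness makes the von Neumann dimension `‖P e‖²` an integer in `[0, 1]`. The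
value `1` would put `e` in the kernel, forcing `α = α * e = 0`. So `P e = 0`, and since the kernel
is invariant under right translation, every `v` in it vanishes
(`eq_zero_of_groupRingAction_eq_zero`). Hence `f = 0` almost everywhere. -/

theorem groupRingAction_apply (α : MonoidAlgebra ℂ Γ) (v : Ell2 Γ) (x : Γ) :
    groupRingAction α v x = α.coeff.sum fun g a => a * v (g⁻¹ * x) := by
  simp only [groupRingAction, Finsupp.sum, sum_apply,
    lp.coeFn_sum, Finset.sum_apply]
  rfl

/-- The right translate `x ↦ v (x * g)` of a square summable function. -/
def rightTranslate (g : Γ) (v : Ell2 Γ) : Ell2 Γ :=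
  ⟨fun x => v (x * g), by
    have h : (0 : ℝ) < (2 : ℝ≥0∞).toReal := by norm_num
    exact memℓp_gen (((Equiv.mulRight g).summable_iff
      (f := fun x : Γ => ‖v x‖ ^ (2 : ℝ≥0∞).toReal)).2 ((memℓp_gen_iff h).1 (lp.memℓp v)))⟩

theorem rightTranslate_apply (g : Γ) (v : Ell2 Γ) (x : Γ) : rightTranslate g v x = v (x * g) :=
  rfl

theorem groupRingAction_rightTranslate (α : MonoidAlgebra ℂ Γ) (g : Γ) (v : Ell2 Γ) :
    groupRingAction α (rightTranslate g v) = rightTranslate g (groupRingAction α v) := by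
  ext x
  simp only [groupRingAction_apply, rightTranslate_apply, mul_assoc]

theorem finiteSubgroupLattice_le_of_torsionFree (hΓ : ∀ g : Γ, IsOfFinOrder g → g = 1) :
    finiteSubgroupLattice Γ ≤ (Int.castAddHom ℝ).range := by
  refine (AddSubgroup.closure_le _).2 ?_
  rintro r ⟨F, hF, rfl⟩
  have hF1 : F = ⊥ := by
    refine (Subgroup.eq_bot_iff_forall F).2 fun x hx => hΓ x ?_
    exact Submonoid.isOfFinOrder_coe.2 (isOfFinOrder_of_finite (⟨x, hx⟩ : F))
  exact ⟨1, by simp [hF1]⟩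

theorem groupRingAction_single_one (α : MonoidAlgebra ℂ Γ) (x : Γ) [DecidableEq Γ] :
    groupRingAction α (lp.single 2 (1 : Γ) (1 : ℂ)) x = α.coeff x := by
  rw [groupRingAction_apply, Finsupp.sum_eq_single x]
  · simp
  · intro b _ hb
    rw [lp.single_apply_ne, mul_zero]
    simpa [inv_mul_eq_one] using hb
  · simp

/-- The `1 × 1` matrix of an element of the group ring acts as that element. -/
theorem mem_ker_matrixOperator_one (α : MonoidAlgebra ℂ Γ) (w : Ell2Pow Γ 1) :
    w ∈ (matrixOperator (m := 1) (n := 1) fun _ _ => α).ker ↔ groupRingAction α (w 0) = 0 := by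
  rw [LinearMap.mem_ker]
  constructor
  · intro h
    have := congrArg (fun u : Ell2Pow Γ 1 => u 0) h
    simpa [matrixOperator] using this
  · intro h
    ext i : 1
    simpa [matrixOperator] using h

theorem re_inner_starProjection_eq_norm_sq {E : Type*} [NormedAddCommGroup E]
    [InnerProductSpace ℂ E] (V : Submodule ℂ E) [V.HasOrthogonalProjection] (x : E) :
    (inner ℂ x (V.starProjection x)).re = ‖V.starProjection x‖ ^ 2 := by
  rw [← V.inner_starProjection_left_eq_right]
  exact V.re_inner_starProjection_eq_normSq (𝕜 := ℂ) x

theorem vonNeumannDim_eq_norm_sq (V : Submodule ℂ (Ell2Pow Γ 1)) [V.HasOrthogonalProjection] :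
    vonNeumannDim V = ‖V.starProjection (standardVector Γ 0)‖ ^ 2 := by
  rw [vonNeumannDim, Fin.sum_univ_one, re_inner_starProjection_eq_norm_sq]

/-- A torsion-free group satisfying the strong Atiyah conjecture has no nonzero group ring element
that annihilates a nonzero square summable function. -/
theorem eq_zero_of_groupRingAction_eq_zero (hΓ : ∀ g : Γ, IsOfFinOrder g → g = 1)
    (hA : StrongAtiyahConjecture Γ) {α : MonoidAlgebra ℂ Γ} (hα : α ≠ 0) {v : Ell2 Γ}
    (hv : groupRingAction α v = 0) : v = 0 := by
  classical
  set V := (matrixOperator (m := 1) (n := 1) fun _ _ => α).ker with hV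
  set e : Ell2Pow Γ 1 := standardVector Γ 0 with he
  have he0 : e 0 = lp.single 2 (1 : Γ) (1 : ℂ) := by
    simp only [he, standardVector]
    convert PiLp.single_eq_same 2 (0 : Fin 1) _
  have hnorm : ‖e‖ = 1 := by
    have h2 : ‖e‖ ^ 2 = 1 := by
      rw [PiLp.norm_sq_eq_of_L2, Fin.sum_univ_one, he0, lp.norm_single (by norm_num)]
      simp
    nlinarith [norm_nonneg e]
  have hdim := vonNeumannDim_eq_norm_sq V
  rw [← he] at hdim
  obtain ⟨z, hz⟩ := finiteSubgroupLattice_le_of_torsionFree hΓ (hA 1 1 fun _ _ => α)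
  have hz' : (z : ℝ) = ‖V.starProjection e‖ ^ 2 := hz.trans hdim
  have hle : ‖V.starProjection e‖ ≤ 1 := hnorm ▸ V.norm_starProjection_apply_le e
  have hz0 : 0 ≤ z := by exact_mod_cast hz' ▸ sq_nonneg _
  have hz1 : z ≤ 1 := by
    have : (z : ℝ) ≤ 1 := by rw [hz']; exact pow_le_one₀ (norm_nonneg _) hle
    exact_mod_cast this
  have hPe : V.starProjection e = 0 := by
    obtain rfl | rfl : z = 0 ∨ z = 1 := by omega
    · simpa using hz'.symm
    · exfalso
      have h1 : ‖V.starProjection e‖ = 1 := by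
        have : ‖V.starProjection e‖ ^ 2 = 1 := by simpa using hz'.symm
        nlinarith [norm_nonneg (V.starProjection e)]
      -- A projection that preserves the norm of a vector fixes it.
      have hmem : e ∈ V := by
        rw [V.mem_iff_norm_starProjection, h1, hnorm]
      rw [hV, mem_ker_matrixOperator_one, he0] at hmem
      refine hα (MonoidAlgebra.coeff_injective (Finsupp.ext fun x => ?_))
      rw [← groupRingAction_single_one, hmem]
      rfl
  ext g
  -- Pairing `e` with the right translate of `v` by `g` reads off `v g`.
  have hmem : (WithLp.toLp 2 fun _ => rightTranslate g v : Ell2Pow Γ 1) ∈ V := by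
    rw [hV, mem_ker_matrixOperator_one]
    change groupRingAction α (rightTranslate g v) = 0
    rw [groupRingAction_rightTranslate, hv]
    rfl
  have h := V.inner_starProjection_left_eq_right (𝕜 := ℂ) e
    (WithLp.toLp 2 fun _ => rightTranslate g v : Ell2Pow Γ 1)
  rw [hPe, inner_zero_left, Submodule.starProjection_eq_self_iff.2 hmem, PiLp.inner_apply,
    Fin.sum_univ_one, he0, lp.inner_single_left] at h
  simpa [rightTranslate_apply] using h.symm

end Group
section Translations

variable {G : Type*} [Group G] [TopologicalSpace G] [IsTopologicalGroup G]

/-- A discrete subgroup of a Hausdorff group is closed, so it inherits σ-compactness. -/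
theorem countable_of_discreteTopology_subgroup [T2Space G] [SigmaCompactSpace G] (K : Subgroup G)
    [DiscreteTopology K] : Countable K :=
  have : SigmaCompactSpace K :=
    (Subgroup.isClosed_of_discrete (H := K)).isClosedEmbedding_subtypeVal.sigmaCompactSpace
  countable_of_Lindelof_of_discrete

/-- Every point has an open neighbourhood whose translates under a discrete subgroup are
pairwise disjoint. -/
theorem exists_isOpen_disjoint_translates (K : Subgroup G) [DiscreteTopology K] (g : G) :
    ∃ U : Set G, IsOpen U ∧ g ∈ U ∧
      Pairwise (Function.onFun Disjoint fun k : K => (fun x : G => (k : G)⁻¹ * x) ⁻¹' U) := by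
  obtain ⟨W, hW, hWK⟩ : ∃ W ∈ nhds (1 : G), ∀ k : K, (k : G) ∈ W → k = 1 := by
    have h : ({1} : Set K) ∈ nhds (1 : K) := by simp
    obtain ⟨W, hW, hWK⟩ := mem_nhds_subtype (K : Set G) 1 _ |>.1 h
    exact ⟨W, hW, fun k hk => hWK hk⟩
  obtain ⟨V, hV, hVW⟩ := exists_nhds_split_inv hW
  refine ⟨(fun x => x * g⁻¹) ⁻¹' interior V, isOpen_interior.preimage (by fun_prop), ?_, ?_⟩
  · simpa using mem_interior_iff_mem_nhds.2 hV
  · intro k k' hkk'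
    refine Set.disjoint_left.2 fun x hx hx' => hkk' ?_
    -- The quotient of `k⁻¹ * x * g⁻¹` by `k'⁻¹ * x * g⁻¹` is `k⁻¹ * k'`.
    have h := hVW _ (interior_subset hx) _ (interior_subset hx')
    have h2 : k⁻¹ * k' = 1 := hWK _ (by
      convert h using 1
      simp only [Subgroup.coe_mul, Subgroup.coe_inv, div_eq_mul_inv]
      group)
    exact inv_mul_eq_one.1 h2

variable [MeasurableSpace G] [BorelSpace G] {μ : Measure G} [μ.IsMulLeftInvariant]

/-- Almost every restriction of a square integrable function to a coset of a discrete subgroup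
is square summable. -/
theorem ae_memℓp_coset [T2Space G] [SigmaCompactSpace G] (K : Subgroup G)
    [DiscreteTopology K] (f : Lp ℂ 2 μ) :
    ∀ᵐ x ∂μ, Memℓp (fun k : K => f ((k : G) * x)) 2 := by
  have := countable_of_discreteTopology_subgroup K
  choose U hUo hUg hUd using exists_isOpen_disjoint_translates K
  obtain ⟨s, hs, hsU⟩ := countable_cover_nhds_of_sigmaCompact fun g => (hUo g).mem_nhds (hUg g)
  suffices h : ∀ g ∈ s, ∀ᵐ x ∂μ.restrict (U g), Memℓp (fun k : K => f ((k : G) * x)) 2 by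
    have h' := (ae_restrict_biUnion_iff U hs _).2 h
    rwa [hsU, Measure.restrict_univ] at h'
  intro g _
  have hmeas : Measurable fun x => ‖f x‖ₑ ^ (2 : ℝ) :=
    (Lp.stronglyMeasurable f).measurable.enorm.pow_const _
  have hfin : ∫⁻ x, ‖f x‖ₑ ^ (2 : ℝ) ∂μ < ∞ := by
    simpa using lintegral_rpow_enorm_lt_top_of_eLpNorm_lt_top (by norm_num) (by norm_num)
      (Lp.memLp f).2
  have hmeasK (k : K) : Measurable fun x => ‖f ((k : G) * x)‖ₑ ^ (2 : ℝ) :=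
    hmeas.comp (measurable_const_mul (k : G))
  -- The translates of `U g` by `K` are disjoint, so the sum of the integrals is at most the
  -- integral of `‖f‖²` over `G`.
  have hint : ∫⁻ x in U g, ∑' k : K, ‖f ((k : G) * x)‖ₑ ^ (2 : ℝ) ∂μ < ∞ := by
    rw [lintegral_tsum fun k => (hmeasK k).aemeasurable]
    have h (k : K) : ∫⁻ x in U g, ‖f ((k : G) * x)‖ₑ ^ (2 : ℝ) ∂μ =
        ∫⁻ x in (fun x : G => (k : G)⁻¹ * x) ⁻¹' U g, ‖f x‖ₑ ^ (2 : ℝ) ∂μ := by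
      rw [← (measurePreserving_mul_left μ (k : G)).setLIntegral_comp_preimage_emb
        (measurableEmbedding_mulLeft (k : G)) (fun x => ‖f x‖ₑ ^ (2 : ℝ))]
      simp [← Set.preimage_comp, Function.comp_def]
    simp_rw [h]
    rw [← lintegral_iUnion (fun k => (hUo g).measurableSet.preimage (measurable_const_mul _))
      (hUd g)]
    exact (setLIntegral_le_lintegral _ _).trans_lt hfin
  filter_upwards [ae_lt_top (.tsum hmeasK) hint.ne] with x hx
  refine memℓp_gen ?_
  have h := ENNReal.summable_toReal hx.ne
  simpa [ENNReal.toReal_rpow] using h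

/-- Translation preserves null sets and `K` is countable, so one null set serves all points of the
coset at once. -/
theorem ae_sum_translate_eq_zero [T2Space G] [SigmaCompactSpace G] (K : Subgroup G)
    [DiscreteTopology K] (f : Lp ℂ 2 μ) (l : K →₀ ℂ)
    (hl : Finsupp.linearCombination ℂ (fun k : K => leftTranslation (k : G) f) l = 0) :
    ∀ᵐ x ∂μ, ∀ k' : K, (l.sum fun k a => a * f ((k : G)⁻¹ * ((k' : G) * x))) = 0 := by
  have := countable_of_discreteTopology_subgroup K
  rw [ae_all_iff]
  intro k'
  refine (measurePreserving_mul_left μ (k' : G)).quasiMeasurePreserving.ae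
    (p := fun x => (l.sum fun k a => a * f ((k : G)⁻¹ * x)) = 0) ?_
  rw [Finsupp.linearCombination_apply, Finsupp.sum] at hl
  have h0 := Lp.coeFn_fun_finsetSum l.support fun k => l k • leftTranslation (k : G) f
  rw [hl] at h0
  have h1 : ∀ᵐ x ∂μ, ∀ k : K, (l k • leftTranslation (k : G) f : Lp ℂ 2 μ) x =
      l k * f ((k : G)⁻¹ * x) := by
    rw [ae_all_iff]
    intro k
    filter_upwards [Lp.coeFn_smul (l k) (leftTranslation (k : G) f),
      Lp.coeFn_compMeasurePreserving f (measurePreserving_mul_left μ (k : G)⁻¹)] with x hx hx'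
    rw [hx, Pi.smul_apply, smul_eq_mul]
    exact congrArg _ hx'
  filter_upwards [h0, h1, Lp.coeFn_zero ℂ 2 μ] with x hx hx1 hx0
  rw [hx0] at hx
  rw [Finsupp.sum, ← Finset.sum_congr rfl fun k _ => hx1 k, ← hx]
  rfl

end Translations

end StrongAtiyah

theorem mainTheorem2 {G : Type*} [Group G] [TopologicalSpace G] [IsTopologicalGroup G]
    [T2Space G] [LocallyCompactSpace G] [SigmaCompactSpace G]
    [MeasurableSpace G] [BorelSpace G] (μ : Measure G) [μ.IsHaarMeasure]
    (K : Subgroup G) [DiscreteTopology K]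
    (hTorsionFree : ∀ k : K, IsOfFinOrder k → k = 1)
    (hAtiyah : StrongAtiyah.StrongAtiyahConjecture K)
    (f : Lp ℂ 2 μ) (hf : f ≠ 0) :
    LinearIndependent ℂ (fun k : K => StrongAtiyah.leftTranslation (k : G) f) := by
  rw [linearIndependent_iff]
  intro l hl
  by_contra hl0
  refine hf ((Lp.eq_zero_iff_ae_eq_zero).2 ?_)
  filter_upwards [StrongAtiyah.ae_memℓp_coset K f,
    StrongAtiyah.ae_sum_translate_eq_zero K f l hl] with x hx hsum
  let v : StrongAtiyah.Ell2 K := ⟨fun k : K => f ((k : G) * x), hx⟩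
  have hα : MonoidAlgebra.ofCoeff l ≠ 0 := fun h => hl0 (congrArg MonoidAlgebra.coeff h)
  have hv : v = 0 := by
    refine StrongAtiyah.eq_zero_of_groupRingAction_eq_zero hTorsionFree hAtiyah hα ?_
    ext k'
    rw [StrongAtiyah.groupRingAction_apply]
    refine Eq.trans (Finsupp.sum_congr fun k _ => ?_) (hsum k')
    change _ * f (((k⁻¹ * k' : K) : G) * x) = _
    simp [mul_assoc]
  have h1 : f (((1 : K) : G) * x) = 0 := congrArg (fun w : StrongAtiyah.Ell2 K => w 1) hv
  simpa using h1
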